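/- A skew brace is a triple $(B,+,\circ)$ such that $(B,+)$ and $(B,\circ)$ are groups and $a\circ(b+c)=a\circ b-a+a\circ c$ for all $a,b,c\in B$; it is of abelian type if $(B,+)$ is abelian. The group $(B,\circ)$ acts on $(B,+)$ by the automorphisms $\lambda_a(b)=-a+a\circ b$. The $\lambda$-graph $\Lambda(B)$ of a finite skew brace $B$ has as vertices the orbits of this action with more than one element, two different orbits being adjacent if and only if their sizes are not coprime. **Theorem.** Let $B$ be a finite skew brace of abelian type such that $\Lambda(B)$ has exactly one vertex. Then $B$ is isomorphic (as a skew brace) to one of the following skew braces, in which $+$ is the usual addition: - the skew brace on $\mathbb{Z}/4\mathbb{Z}$ with $x\circ y=x+y+2xy$; - the skew brace on $\mathbb{Z}/2\mathbb{Z}\times\mathbb{Z}/2\mathbb{Z}$ with $$(x_1,y_1)\circ(x_2,y_2)=(x_1+x_2+y_1y_2,\;y_1+y_2);$$ - the skew brace on $\mathbb{Z}/2\mathbb{Z}\times\mathbb{Z}/4\mathbb{Z}$ with $$(x_1,y_1)\circ(x_2,y_2)=\Bigl(x_1+x_2+y_2\sum_{i=1}^{y_1-1}i,\;y_1+y_2+2y_1y_2\Bigr),$$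 where in the sum $y_1$ is represented by an element of $\{0,1,2,3\}$ (the sum is $0$ if $y_1\in\{0,1\}$), and the product $y_2\sum_{i=1}^{y_1-1}i$ is taken modulo $2$. In particular, $|B|\le 8$. -/

import Mathlib

universe u v w

/-- A skew brace `(A, +, ∘)`: `(A, +)` and `(A, ∘)` are groups (neither is assumed commutative) with
`a ∘ (b + c) = a ∘ b - a + a ∘ c`. The operation `∘` is written as the multiplication `*`. -/
class SkewBrace (A : Type u) extends AddGroup A, Group A where
  circ_add : ∀ a b c : A, a * (b + c) = a * b - a + a * c

namespace SkewBrace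

/-- `A` is of abelian type: the additive group `(A, +)` is abelian. -/
def IsOfAbelianType (A : Type u) [SkewBrace A] : Prop :=
  ∀ a b : A, a + b = b + a

/-- An isomorphism of skew braces: a bijection preserving both operations. -/
structure Iso (A : Type u) (B : Type v) [SkewBrace A] [SkewBrace B] extends A ≃ B where
  map_add' : ∀ x y : A, toFun (x + y) = toFun x + toFun y
  map_circ' : ∀ x y : A, toFun (x * y) = toFun x * toFun y

section Lambda

variable {A : Type u} [SkewBrace A]

theorem circ_zero (a : A) : a * (0 : A) = a := by
  have h := circ_add a 0 0
  rw [add_zero, sub_eq_add_neg, add_assoc] at h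
  have h2 : -a + a * (0 : A) = 0 := by
    simpa using h
  exact (neg_add_eq_zero.mp h2).symm

theorem zero_eq_one : (0 : A) = 1 := by
  have h := circ_zero (1 : A)
  rwa [one_mul] at h

/-- The additive automorphism `λ_a : b ↦ -a + a ∘ b`. -/
def lambdaAut (a : A) : AddAut A where
  toFun b := -a + a * b
  invFun b := a⁻¹ * (a + b)
  left_inv b := by simp
  right_inv b := by simp
  map_add' b c := by
    rw [circ_add]
    simp only [sub_eq_add_neg, add_assoc]

/-- The homomorphism `λ : (A, ∘) → Aut(A, +)`, `λ_a(b) = -a + a ∘ b`. (Mathlib writes the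
composition group `AddAut A` additively, hence `Multiplicative`.) -/
def lambda (A : Type u) [SkewBrace A] : A →* Multiplicative (AddAut A) where
  toFun a := Multiplicative.ofAdd (lambdaAut a)
  map_one' := by
    refine congrArg Multiplicative.ofAdd (AddEquiv.ext fun b => ?_)
    change -(1 : A) + 1 * b = b
    rw [one_mul, ← zero_eq_one, neg_zero, zero_add]
  map_mul' a b := by
    refine congrArg Multiplicative.ofAdd (AddEquiv.ext fun c => ?_)
    change -(a * b) + a * b * c = -a + a * (-b + b * c)
    have h := circ_add a b (-b + b * c)
    rw [add_neg_cancel_left, ← mul_assoc] at h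
    rw [h]
    simp only [sub_eq_add_neg, add_assoc, neg_add_cancel_left]

end Lambda

end SkewBrace

section CommonDivisorGraph

variable {G : Type u} {H : Type v} [Group G] [AddGroup H]

/-- The orbit of `a` under an action of the group `G` on `H` by automorphisms. -/
def actionOrbit (α : G →* Multiplicative (AddAut H)) (a : H) : Set H :=
  Set.range fun g : G => (α g).toAdd a

/-- The non-trivial orbits (those with more than one element) of an action on a finite group. -/
def NontrivialOrbit (α : G →* Multiplicative (AddAut H)) : Type v :=
  {L : Set H // (∃ a : H, L = actionOrbit α a) ∧ 1 < L.ncard}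

/-- The common divisor graph of an action of `G` on a finite group `H` by automorphisms: its vertices
are the non-trivial orbits, and two different vertices are adjacent when their sizes are not
coprime. -/
def commonDivisorGraph (α : G →* Multiplicative (AddAut H)) : SimpleGraph (NontrivialOrbit α) where
  Adj L₁ L₂ := L₁ ≠ L₂ ∧ Nat.gcd L₁.1.ncard L₂.1.ncard ≠ 1
  symm := ⟨fun L₁ L₂ h => ⟨h.1.symm, by rw [Nat.gcd_comm]; exact h.2⟩⟩
  loopless := ⟨fun _ h => h.1 rfl⟩

end CommonDivisorGraph

/-- The `λ`-graph of a finite skew brace. -/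
def lambdaGraph (A : Type u) [SkewBrace A] : SimpleGraph (NontrivialOrbit (SkewBrace.lambda A)) :=
  commonDivisorGraph (SkewBrace.lambda A)

/-- The graph has exactly one vertex. -/
def HasExactlyOneVertex {V : Type w} (_Γ : SimpleGraph V) : Prop :=
  Nat.card V = 1

section Examples

/-- A skew brace on an additive group `A` from an operation `circ` on `A` (with neutral element `0`
and inverse `inv`). -/
abbrev SkewBrace.ofCirc (A : Type u) [AddGroup A] (circ : A → A → A) (inv : A → A)
    (assoc : ∀ a b c, circ (circ a b) c = circ a (circ b c))
    (zero_circ : ∀ a, circ 0 a = a) (inv_circ : ∀ a, circ (inv a) a = 0)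
    (circ_add : ∀ a b c, circ a (b + c) = circ a b - a + circ a c) : SkewBrace A :=
  letI : Mul A := ⟨circ⟩
  letI : Inv A := ⟨inv⟩
  letI : One A := ⟨0⟩
  { ‹AddGroup A›, Group.ofLeftAxioms assoc zero_circ inv_circ with
    circ_add := circ_add }

/-- `x ∘ y = x + y + 2xy` on `ℤ/4`. -/
def circZ4 (x y : ZMod 4) : ZMod 4 :=
  x + y + 2 * x * y

/-- The skew brace with additive group `ℤ/4` and circle operation `circZ4`. -/
def BraceZ4 : Type := ZMod 4

instance : SkewBrace BraceZ4 :=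
  SkewBrace.ofCirc (ZMod 4) circZ4 (fun x => x)
    (by decide)
    (by decide)
    (by decide)
    (by decide)

/-- `(x₁, y₁) ∘ (x₂, y₂) = (x₁ + x₂ + y₁y₂, y₁ + y₂)` on `ℤ/2 × ℤ/2`. -/
def circZ2Z2 (a b : ZMod 2 × ZMod 2) : ZMod 2 × ZMod 2 :=
  (a.1 + b.1 + a.2 * b.2, a.2 + b.2)

/-- The skew brace with additive group `ℤ/2 × ℤ/2` and circle operation `circZ2Z2`. -/
def BraceZ2Z2 : Type := ZMod 2 × ZMod 2

instance : SkewBrace BraceZ2Z2 :=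
  SkewBrace.ofCirc (ZMod 2 × ZMod 2) circZ2Z2 (fun a => (a.1 + a.2, a.2))
    (by decide)
    (by decide)
    (by decide)
    (by decide)

/-- `∑_{i=1}^{y-1} i` modulo 2, for the representative `y ∈ {0, 1, 2, 3}`. -/
def sumBelow (y : ZMod 4) : ZMod 2 :=
  ∑ i ∈ Finset.Ico 1 y.val, (i : ZMod 2)

/-- `(x₁, y₁) ∘ (x₂, y₂) = (x₁ + x₂ + y₂ ∑_{i=1}^{y₁-1} i, y₁ + y₂ + 2y₁y₂)` on `ℤ/2 × ℤ/4`, where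
`y₂` is reduced modulo 2 in the first component. -/
def circZ2Z4 (a b : ZMod 2 × ZMod 4) : ZMod 2 × ZMod 4 :=
  (a.1 + b.1 + (b.2.val : ZMod 2) * sumBelow a.2, a.2 + b.2 + 2 * a.2 * b.2)

/-- The skew brace with additive group `ℤ/2 × ℤ/4` and circle operation `circZ2Z4`. -/
def BraceZ2Z4 : Type := ZMod 2 × ZMod 4

instance : SkewBrace BraceZ2Z4 :=
  SkewBrace.ofCirc (ZMod 2 × ZMod 4) circZ2Z4
    (fun a => (a.1 + (a.2.val : ZMod 2) * sumBelow a.2, -(a.2 * (1 + 2 * a.2))))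
    (by decide +kernel)
    (by decide +kernel)
    (by decide +kernel)
    (by decide +kernel)

end Examples

/-!
The fixed points of `λ` form an additive subgroup `F`, and the only nontrivial orbit is its
complement. The size of that orbit divides `|B|`, which forces `F` to have index two. Fix `c ∉ F`
and put `δ a = -c + λ_a c`. Then `δ` is a homomorphism from `(B, ∘)` onto `F`, and `a ∘ b` is
`a + b` or `a + b + δ a` according to whether `b` lies in `F` or not. As `c + c ∈ F` is fixed, `F`
has exponent two. Since `δ` is also additive on `F` with `δ ∘ δ = 0` there, `F` consists of `0`,
`δ c`, `δ (δ c)` and their sum. Hence `B` is determined by its additive group together with the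
three elements `c`, `δ c` and `δ (δ c)`. The three braces of the theorem correspond to
`δ (δ c) = 0` with `c + c = δ c`, to `δ (δ c) = 0` with `c + c = 0`, and to `δ (δ c) ≠ 0`, where
`c` can be chosen so that `c + c = δ c`.
-/

section Action

variable {G : Type u} {H : Type v} [Group G] [AddGroup H] {α : G →* Multiplicative (AddAut H)}

/-- The subgroup of elements of `H` fixed by an action of `G` on `H` by automorphisms. -/
def actionFixedPoints (α : G →* Multiplicative (AddAut H)) : AddSubgroup H where
  carrier := {x | ∀ g : G, (α g).toAdd x = x}
  zero_mem' _ := map_zero _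
  add_mem' hx hy g := by rw [map_add, hx g, hy g]
  neg_mem' hx g := by rw [map_neg, hx g]

theorem mem_actionFixedPoints {x : H} :
    x ∈ actionFixedPoints α ↔ ∀ g : G, (α g).toAdd x = x :=
  Iff.rfl

theorem toAdd_one_apply (x : H) : (α 1).toAdd x = x := by
  rw [map_one]
  rfl

theorem toAdd_mul_apply (g h : G) (x : H) : (α (g * h)).toAdd x = (α g).toAdd ((α h).toAdd x) := by
  rw [map_mul]
  rfl

theorem self_mem_actionOrbit (x : H) : x ∈ actionOrbit α x :=
  ⟨1, toAdd_one_apply x⟩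

theorem toAdd_apply_mem_actionFixedPoints_iff {g : G} {x : H} :
    (α g).toAdd x ∈ actionFixedPoints α ↔ x ∈ actionFixedPoints α := by
  refine ⟨fun h => ?_, fun h => by rwa [h g]⟩
  have h_inv := h g⁻¹
  rw [← toAdd_mul_apply, inv_mul_cancel, toAdd_one_apply] at h_inv
  rwa [h_inv]

theorem ncard_actionOrbit_dvd_card (x : H) : (actionOrbit α x).ncard ∣ Nat.card G := by
  let _ : MulAction G H :=
    { smul g y := (α g).toAdd y
      one_smul := toAdd_one_apply
      mul_smul := toAdd_mul_apply }
  have h := (MulAction.stabilizer G x).index_dvd_card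
  rwa [MulAction.index_stabilizer] at h

theorem one_lt_ncard_actionOrbit_iff [Finite H] {x : H} :
    1 < (actionOrbit α x).ncard ↔ x ∉ actionFixedPoints α := by
  rw [Set.one_lt_ncard (Set.toFinite _), mem_actionFixedPoints, not_forall]
  constructor
  · rintro ⟨_, ⟨g, rfl⟩, _, ⟨h, rfl⟩, hne⟩
    by_contra! hx
    exact hne ((hx g).trans (hx h).symm)
  · rintro ⟨g, hg⟩
    exact ⟨_, ⟨g, rfl⟩, x, self_mem_actionOrbit x, hg⟩

theorem exists_notMem_actionFixedPoints [Finite H]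
    (hone : HasExactlyOneVertex (commonDivisorGraph α)) : ∃ x, x ∉ actionFixedPoints α := by
  obtain ⟨-, ⟨⟨_, ⟨x, rfl⟩, hx⟩⟩⟩ := Nat.card_eq_one_iff_unique.1 hone
  exact ⟨x, one_lt_ncard_actionOrbit_iff.1 hx⟩

theorem actionOrbit_eq_compl_actionFixedPoints [Finite H]
    (hone : HasExactlyOneVertex (commonDivisorGraph α)) {x : H} (hx : x ∉ actionFixedPoints α) :
    actionOrbit α x = (actionFixedPoints α : Set H)ᶜ := by
  refine Set.Subset.antisymm ?_ fun y hy => ?_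
  · rintro _ ⟨g, rfl⟩
    exact toAdd_apply_mem_actionFixedPoints_iff.not.2 hx
  · have h_subsingleton := (Nat.card_eq_one_iff_unique.1 hone).1
    have h_orbits : actionOrbit α x = actionOrbit α y :=
      congrArg Subtype.val (h_subsingleton.elim
        ⟨_, ⟨x, rfl⟩, one_lt_ncard_actionOrbit_iff.2 hx⟩
        ⟨_, ⟨y, rfl⟩, one_lt_ncard_actionOrbit_iff.2 hy⟩)
    exact h_orbits ▸ self_mem_actionOrbit y

end Action

section IndexTwo

variable {G : Type u} [AddGroup G] {H : AddSubgroup G}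

theorem exists_notMem_of_index_eq_two (h : H.index = 2) : ∃ x, x ∉ H := by
  by_contra! hH
  simp [(AddSubgroup.eq_top_iff' H).2 hH] at h

theorem neg_add_mem_iff_of_index_eq_two (h : H.index = 2) {a b : G} :
    -a + b ∈ H ↔ (a ∈ H ↔ b ∈ H) := by
  rw [AddSubgroup.add_mem_iff_of_index_two h, neg_mem_iff]

theorem sub_mem_iff_of_index_eq_two (h : H.index = 2) {a b : G} :
    a - b ∈ H ↔ (a ∈ H ↔ b ∈ H) := by
  rw [sub_eq_add_neg, AddSubgroup.add_mem_iff_of_index_two h, neg_mem_iff]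

theorem index_eq_two_of_ncard_compl_dvd_card [Finite G]
    (hdvd : (H : Set G)ᶜ.ncard ∣ Nat.card G) : H.index = 2 := by
  have hcompl : Nat.card H + (H : Set G)ᶜ.ncard = Nat.card G := by
    rw [← Set.ncard_add_ncard_compl (H : Set G), ← Nat.card_coe_set_eq]
    rfl
  obtain ⟨k, hk⟩ := Nat.exists_eq_succ_of_ne_zero H.index_ne_zero_of_finite
  have hcard : Nat.card H * k + Nat.card H = Nat.card G := by
    rw [← H.card_mul_index, hk, Nat.mul_succ]
  have hncard : (H : Set G)ᶜ.ncard = Nat.card H * k := by lia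
  have hk_dvd : k ∣ k + 1 := by
    refine Nat.dvd_of_mul_dvd_mul_left (Nat.card_pos (α := H)) ?_
    rwa [mul_add, mul_one, hcard, ← hncard]
  rw [hk, Nat.dvd_one.1 ((Nat.dvd_add_right dvd_rfl).1 hk_dvd)]

end IndexTwo

namespace SkewBrace

section Displacement

variable {B : Type u} [SkewBrace B] {a b c : B}

theorem mul_eq_add_lambdaAut (a b : B) : a * b = a + lambdaAut a b :=
  (add_neg_cancel_left a (a * b)).symm

theorem lambdaAut_mul (a b x : B) : lambdaAut (a * b) x = lambdaAut a (lambdaAut b x) :=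
  toAdd_mul_apply (α := lambda B) a b x

/-- The subgroup of `(B, +)` of the elements fixed by all `λ_a`. -/
abbrev fixedPoints (B : Type u) [SkewBrace B] : AddSubgroup B :=
  actionFixedPoints (lambda B)

theorem mem_fixedPoints {x : B} : x ∈ fixedPoints B ↔ ∀ a : B, lambdaAut a x = x :=
  Iff.rfl

theorem lambdaAut_mem_fixedPoints_iff {x : B} :
    lambdaAut a x ∈ fixedPoints B ↔ x ∈ fixedPoints B :=
  toAdd_apply_mem_actionFixedPoints_iff (α := lambda B)

theorem mul_eq_add_of_mem_fixedPoints (a : B) (hb : b ∈ fixedPoints B) : a * b = a + b := by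
  rw [mul_eq_add_lambdaAut, mem_fixedPoints.1 hb a]

/-- The displacement `-c + λ_a(c)` of `c` under `λ_a`, as a function of `a`. -/
def displacement (c a : B) : B :=
  -c + lambdaAut a c

theorem add_displacement (c a : B) : c + displacement c a = lambdaAut a c :=
  add_neg_cancel_left c _

theorem displacement_mem_fixedPoints (hF : (fixedPoints B).index = 2) (c a : B) :
    displacement c a ∈ fixedPoints B :=
  (neg_add_mem_iff_of_index_eq_two hF).2 lambdaAut_mem_fixedPoints_iff.symm

theorem displacement_mul (hF : (fixedPoints B).index = 2) (c a b : B) :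
    displacement c (a * b) = displacement c a + displacement c b := by
  have hb : lambdaAut a (displacement c b) = displacement c b :=
    displacement_mem_fixedPoints hF c b a
  rw [displacement, lambdaAut_mul, ← add_displacement c b, map_add, hb, ← add_assoc, ← displacement]

theorem displacement_add_of_mem_fixedPoints (hF : (fixedPoints B).index = 2) (c a : B)
    (hb : b ∈ fixedPoints B) : displacement c (a + b) = displacement c a + displacement c b := by
  rw [← mul_eq_add_of_mem_fixedPoints a hb, displacement_mul hF]

theorem displacement_add_displacement (hF : (fixedPoints B).index = 2) (c a x : B) :
    displacement c (a + displacement c x) =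
      displacement c a + displacement c (displacement c x) :=
  displacement_add_of_mem_fixedPoints hF c a (displacement_mem_fixedPoints hF c x)

theorem displacement_zero (c : B) : displacement c 0 = 0 := by
  rw [displacement, zero_eq_one, show lambdaAut 1 c = c from toAdd_one_apply (α := lambda B) c,
    neg_add_cancel, zero_eq_one]

theorem lambdaAut_eq_add_displacement (hF : (fixedPoints B).index = 2)
    (hb : b ∉ fixedPoints B) (hc : c ∉ fixedPoints B) (a : B) :
    lambdaAut a b = b + displacement c a := by
  have h : lambdaAut a (b - c) = b - c := (sub_mem_iff_of_index_eq_two hF).2 (iff_of_false hb hc) a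
  rw [← sub_add_cancel b c, map_add, h, add_assoc, add_displacement]

theorem displacement_eq_of_notMem_fixedPoints (hF : (fixedPoints B).index = 2)
    (hb : b ∉ fixedPoints B) (hc : c ∉ fixedPoints B) : displacement b = displacement c := by
  ext a
  rw [displacement, lambdaAut_eq_add_displacement hF hb hc, neg_add_cancel_left]

theorem mul_eq_add_add_displacement (hF : (fixedPoints B).index = 2)
    (hb : b ∉ fixedPoints B) (hc : c ∉ fixedPoints B) (a : B) :
    a * b = a + b + displacement c a := by
  rw [mul_eq_add_lambdaAut, lambdaAut_eq_add_displacement hF hb hc, add_assoc]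

end Displacement

/-- The elements moved by `λ` form a single coset of the subgroup of fixed points, and a single
orbit of `λ`. -/
structure MovesSingleCoset (B : Type u) [SkewBrace B] : Prop where
  index_fixedPoints : (fixedPoints B).index = 2
  exists_lambdaAut_eq : ∀ x ∉ fixedPoints B, ∀ y ∉ fixedPoints B, ∃ a : B, lambdaAut a x = y

theorem movesSingleCoset_of_hasExactlyOneVertex {B : Type u} [SkewBrace B] [Finite B]
    (hone : HasExactlyOneVertex (lambdaGraph B)) : MovesSingleCoset B := by
  have orbit_eq {x : B} (hx : x ∉ fixedPoints B) := actionOrbit_eq_compl_actionFixedPoints hone hx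
  refine ⟨?_, fun x hx y hy => (orbit_eq hx).superset hy⟩
  obtain ⟨c, hc⟩ := exists_notMem_actionFixedPoints hone
  refine index_eq_two_of_ncard_compl_dvd_card ?_
  rw [← orbit_eq hc]
  exact ncard_actionOrbit_dvd_card c

/-- The additive group of a skew brace of abelian type. -/
abbrev IsOfAbelianType.addCommGroup {B : Type u} [SkewBrace B] (hab : IsOfAbelianType B) :
    AddCommGroup B where
  add_comm := hab

namespace MovesSingleCoset

variable {B : Type u} [SkewBrace B] {c x : B}

theorem exists_displacement_eq (h : MovesSingleCoset B) (hc : c ∉ fixedPoints B)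
    (hx : x ∈ fixedPoints B) : ∃ a, displacement c a = x := by
  have hcx : c + x ∉ fixedPoints B := by rwa [AddSubgroup.add_mem_cancel_right _ hx]
  obtain ⟨a, ha⟩ := h.exists_lambdaAut_eq c hc _ hcx
  exact ⟨a, by rw [displacement, ha, neg_add_cancel_left]⟩

theorem add_self_eq_zero (h : MovesSingleCoset B) (hab : IsOfAbelianType B)
    (hx : x ∈ fixedPoints B) : x + x = 0 := by
  let _ := hab.addCommGroup
  have hF := h.index_fixedPoints
  obtain ⟨c, hc⟩ := exists_notMem_of_index_eq_two hF
  obtain ⟨a, rfl⟩ := h.exists_displacement_eq hc hx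
  have hcc : lambdaAut a (c + c) = c + c := (AddSubgroup.add_mem_iff_of_index_two hF).2 Iff.rfl a
  have key : (c + c) + (displacement c a + displacement c a) = c + c := by
    rw [add_add_add_comm, add_displacement, ← map_add, hcc]
  exact add_eq_left.1 key

theorem neg_add_mem (h : MovesSingleCoset B) (hc : c ∉ fixedPoints B) (hx : x ∉ fixedPoints B) :
    -c + x ∈ fixedPoints B :=
  (neg_add_mem_iff_of_index_eq_two h.index_fixedPoints).2 (iff_of_false hc hx)

theorem displacement_displacement_of_mem (h : MovesSingleCoset B) (hab : IsOfAbelianType B)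
    (hc : c ∉ fixedPoints B) (hx : x ∈ fixedPoints B) :
    displacement c (displacement c x) = 0 := by
  have hF := h.index_fixedPoints
  -- Compare the values of `δ = displacement c` at `x ∘ c = c + x + δ x` and at `c ∘ x = c + x`.
  have key := displacement_mul hF c x c
  rw [mul_eq_add_add_displacement hF hc hc, hab x c, displacement_add_displacement hF,
    displacement_add_of_mem_fixedPoints hF c c hx, hab (displacement c x)] at key
  exact add_eq_left.1 key

theorem displacement_displacement_displacement (h : MovesSingleCoset B) (hab : IsOfAbelianType B)
    (hc : c ∉ fixedPoints B) (x : B) :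
    displacement c (displacement c (displacement c x)) = 0 :=
  h.displacement_displacement_of_mem hab hc (displacement_mem_fixedPoints h.index_fixedPoints c x)

theorem displacement_add_self (h : MovesSingleCoset B) (hab : IsOfAbelianType B)
    (hc : c ∉ fixedPoints B) : displacement c (c + c) = displacement c (displacement c c) := by
  have hF := h.index_fixedPoints
  have hδ := displacement_mem_fixedPoints hF c
  have key := displacement_mul hF c c c
  rw [mul_eq_add_add_displacement hF hc hc, displacement_add_displacement hF,
    h.add_self_eq_zero hab (hδ c), ← h.add_self_eq_zero hab (hδ (displacement c c))] at key
  exact add_right_cancel key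

theorem displacement_of_notMem (h : MovesSingleCoset B) (hc : c ∉ fixedPoints B)
    (hx : x ∉ fixedPoints B) :
    displacement c x = displacement c c + displacement c (-c + x) := by
  rw [← displacement_add_of_mem_fixedPoints h.index_fixedPoints c c (h.neg_add_mem hc hx),
    add_neg_cancel_left]

theorem displacement_eq_zero_or_of_mem (h : MovesSingleCoset B) (hab : IsOfAbelianType B)
    (hc : c ∉ fixedPoints B) (hx : x ∈ fixedPoints B) :
    displacement c x = 0 ∨ displacement c x = displacement c (displacement c c) := by
  obtain ⟨y, rfl⟩ := h.exists_displacement_eq hc hx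
  by_cases hy : y ∈ fixedPoints B
  · exact .inl (h.displacement_displacement_of_mem hab hc hy)
  · right
    rw [h.displacement_of_notMem hc hy, displacement_add_displacement h.index_fixedPoints,
      h.displacement_displacement_of_mem hab hc (h.neg_add_mem hc hy), add_zero]

theorem eq_of_mem_fixedPoints (h : MovesSingleCoset B) (hab : IsOfAbelianType B)
    (hc : c ∉ fixedPoints B) (hx : x ∈ fixedPoints B) :
    x = 0 ∨ x = displacement c (displacement c c) ∨ x = displacement c c ∨
      x = displacement c c + displacement c (displacement c c) := by
  obtain ⟨y, rfl⟩ := h.exists_displacement_eq hc hx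
  by_cases hy : y ∈ fixedPoints B
  · rcases h.displacement_eq_zero_or_of_mem hab hc hy with hδ | hδ <;> simp [hδ]
  · rw [h.displacement_of_notMem hc hy]
    rcases h.displacement_eq_zero_or_of_mem hab hc (h.neg_add_mem hc hy) with hδ | hδ <;>
      simp [hδ]

theorem displacement_self_ne_zero (h : MovesSingleCoset B) (hab : IsOfAbelianType B)
    (hc : c ∉ fixedPoints B) : displacement c c ≠ 0 := by
  intro hv
  refine hc (mem_fixedPoints.2 fun a => ?_)
  have hδa : displacement c a = 0 := by
    rcases h.eq_of_mem_fixedPoints hab hc (displacement_mem_fixedPoints h.index_fixedPoints c a)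
      with h0 | h0 | h0 | h0 <;> simp [h0, hv, displacement_zero]
  rw [← add_displacement, hδa, add_zero]

end MovesSingleCoset

section Rigidity

variable {A : Type u} {B : Type v} [SkewBrace A] [SkewBrace B] {φ : A →+ B} {a c : A}

/-- The additive map `φ` respects the base point `c`: neither `c` nor `φ c` is fixed by `λ`, and the
iterated displacements `δ c` and `δ (δ c)` of `c`, where `δ = displacement c`, are sent to those of
`φ c`. Such a `φ` is automatically multiplicative when both braces move a single coset. -/
structure RespectsBasePoint (φ : A →+ B) (c : A) : Prop where
  notMem : c ∉ fixedPoints A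
  map_notMem : φ c ∉ fixedPoints B
  map_displacement_self : φ (displacement c c) = displacement (φ c) (φ c)
  map_displacement_displacement : φ (displacement c (displacement c c)) =
    displacement (φ c) (displacement (φ c) (φ c))

namespace RespectsBasePoint

theorem map_mem_fixedPoints (h : RespectsBasePoint φ c) (hA : MovesSingleCoset A)
    (habA : IsOfAbelianType A) (hB : MovesSingleCoset B) (ha : a ∈ fixedPoints A) :
    φ a ∈ fixedPoints B := by
  have hδ := displacement_mem_fixedPoints hB.index_fixedPoints (φ c)
  rcases hA.eq_of_mem_fixedPoints habA h.notMem ha with rfl | rfl | rfl | rfl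
  · rw [map_zero]
    exact zero_mem _
  · exact h.map_displacement_displacement ▸ hδ _
  · exact h.map_displacement_self ▸ hδ _
  · rw [map_add, h.map_displacement_self, h.map_displacement_displacement]
    exact add_mem (hδ _) (hδ _)

theorem map_mem_fixedPoints_iff (h : RespectsBasePoint φ c) (hA : MovesSingleCoset A)
    (habA : IsOfAbelianType A) (hB : MovesSingleCoset B) :
    φ a ∈ fixedPoints B ↔ a ∈ fixedPoints A := by
  refine ⟨fun hφa => ?_, h.map_mem_fixedPoints hA habA hB⟩
  by_contra ha
  have hφca := h.map_mem_fixedPoints hA habA hB (hA.neg_add_mem h.notMem ha)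
  rw [map_add, map_neg, neg_add_mem_iff_of_index_eq_two hB.index_fixedPoints] at hφca
  exact h.map_notMem (hφca.2 hφa)

theorem map_displacement_of_mem (h : RespectsBasePoint φ c) (hA : MovesSingleCoset A)
    (habA : IsOfAbelianType A) (hB : MovesSingleCoset B) (habB : IsOfAbelianType B)
    (ha : a ∈ fixedPoints A) : φ (displacement c a) = displacement (φ c) (φ a) := by
  have hδA := hA.displacement_displacement_displacement habA h.notMem c
  have hδB := hB.displacement_displacement_displacement habB h.map_notMem (φ c)
  rcases hA.eq_of_mem_fixedPoints habA h.notMem ha with rfl | rfl | rfl | rfl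
  · simp only [map_zero, displacement_zero]
  · rw [hδA, h.map_displacement_displacement, hδB, map_zero]
  · rw [h.map_displacement_displacement, h.map_displacement_self]
  · rw [displacement_add_displacement hA.index_fixedPoints, hδA, add_zero, map_add,
      h.map_displacement_self, h.map_displacement_displacement,
      displacement_add_displacement hB.index_fixedPoints, hδB, add_zero]

theorem map_displacement (h : RespectsBasePoint φ c) (hA : MovesSingleCoset A)
    (habA : IsOfAbelianType A) (hB : MovesSingleCoset B) (habB : IsOfAbelianType B) (a : A) :
    φ (displacement c a) = displacement (φ c) (φ a) := by
  by_cases ha : a ∈ fixedPoints A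
  · exact h.map_displacement_of_mem hA habA hB habB ha
  · have hφa := (h.map_mem_fixedPoints_iff hA habA hB).not.2 ha
    rw [hA.displacement_of_notMem h.notMem ha, hB.displacement_of_notMem h.map_notMem hφa, map_add,
      h.map_displacement_self,
      h.map_displacement_of_mem hA habA hB habB (hA.neg_add_mem h.notMem ha), map_add, map_neg]

theorem map_mul (h : RespectsBasePoint φ c) (hA : MovesSingleCoset A) (habA : IsOfAbelianType A)
    (hB : MovesSingleCoset B) (habB : IsOfAbelianType B) (a b : A) : φ (a * b) = φ a * φ b := by
  have hφb := h.map_mem_fixedPoints_iff hA habA hB (a := b)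
  by_cases hb : b ∈ fixedPoints A
  · rw [mul_eq_add_of_mem_fixedPoints a hb, mul_eq_add_of_mem_fixedPoints _ (hφb.2 hb), map_add]
  · rw [mul_eq_add_add_displacement hA.index_fixedPoints hb h.notMem,
      mul_eq_add_add_displacement hB.index_fixedPoints (hφb.not.2 hb) h.map_notMem, map_add,
      map_add, h.map_displacement hA habA hB habB]

theorem map_injective (h : RespectsBasePoint φ c) (hA : MovesSingleCoset A)
    (habA : IsOfAbelianType A) (hB : MovesSingleCoset B) (habB : IsOfAbelianType B)
    (hzero : displacement (φ c) (displacement (φ c) (φ c)) = 0 →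
      displacement c (displacement c c) = 0) :
    Function.Injective φ := by
  rw [injective_iff_map_eq_zero]
  intro a ha
  have hv : φ (displacement c c) ≠ 0 := by
    rw [h.map_displacement_self]
    exact hB.displacement_self_ne_zero habB h.map_notMem
  have hu (hφu : φ (displacement c (displacement c c)) = 0) :
      displacement c (displacement c c) = 0 :=
    hzero (h.map_displacement_displacement ▸ hφu)
  have hδ : φ (displacement c a) = 0 := by
    rw [h.map_displacement hA habA hB habB, ha, displacement_zero]
  have ha_mem : a ∈ fixedPoints A := (h.map_mem_fixedPoints_iff hA habA hB).1 (ha ▸ zero_mem _)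
  rcases hA.eq_of_mem_fixedPoints habA h.notMem ha_mem with rfl | rfl | rfl | rfl
  · rfl
  · exact hu ha
  · exact absurd ha hv
  · rw [displacement_add_displacement hA.index_fixedPoints,
      hA.displacement_displacement_displacement habA h.notMem, add_zero] at hδ
    rw [hu hδ, add_zero] at ha
    exact absurd ha hv

theorem map_surjective (h : RespectsBasePoint φ c) (hB : MovesSingleCoset B)
    (habB : IsOfAbelianType B) : Function.Surjective φ := by
  have hv : displacement (φ c) (φ c) ∈ φ.range := ⟨_, h.map_displacement_self⟩
  have hu : displacement (φ c) (displacement (φ c) (φ c)) ∈ φ.range :=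
    ⟨_, h.map_displacement_displacement⟩
  have mem_range_of_mem {x : B} (hx : x ∈ fixedPoints B) : x ∈ φ.range := by
    rcases hB.eq_of_mem_fixedPoints habB h.map_notMem hx with rfl | rfl | rfl | rfl
    exacts [zero_mem _, hu, hv, add_mem hv hu]
  intro b
  by_cases hb : b ∈ fixedPoints B
  · exact mem_range_of_mem hb
  · have hφc : φ c ∈ φ.range := ⟨c, rfl⟩
    have hb_range := add_mem hφc (mem_range_of_mem (hB.neg_add_mem h.map_notMem hb))
    rwa [add_neg_cancel_left] at hb_range

theorem nonempty_iso (h : RespectsBasePoint φ c) (hA : MovesSingleCoset A)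
    (habA : IsOfAbelianType A) (hB : MovesSingleCoset B) (habB : IsOfAbelianType B)
    (hzero : displacement (φ c) (displacement (φ c) (φ c)) = 0 →
      displacement c (displacement c c) = 0) :
    Nonempty (Iso B A) := by
  have hφ : Function.Bijective φ :=
    ⟨h.map_injective hA habA hB habB hzero, h.map_surjective hB habB⟩
  let ψ : A →ₙ* B := ⟨φ, h.map_mul hA habA hB habB⟩
  exact ⟨(Equiv.ofBijective φ hφ).symm, (AddEquiv.ofBijective φ hφ).symm.map_add,
    (MulEquiv.ofBijective ψ hφ).symm.map_mul⟩

end RespectsBasePoint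

end Rigidity

instance : Fintype BraceZ4 := inferInstanceAs (Fintype (ZMod 4))

instance : DecidableEq BraceZ4 := inferInstanceAs (DecidableEq (ZMod 4))

instance : Fintype BraceZ2Z2 := inferInstanceAs (Fintype (ZMod 2 × ZMod 2))

instance : DecidableEq BraceZ2Z2 := inferInstanceAs (DecidableEq (ZMod 2 × ZMod 2))

instance : Fintype BraceZ2Z4 := inferInstanceAs (Fintype (ZMod 2 × ZMod 4))

instance : DecidableEq BraceZ2Z4 := inferInstanceAs (DecidableEq (ZMod 2 × ZMod 4))

instance {B : Type u} [SkewBrace B] [Fintype B] [DecidableEq B] :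
    DecidablePred (· ∈ fixedPoints B) :=
  fun _ => decidable_of_iff _ mem_fixedPoints.symm

theorem isOfAbelianType_braceZ4 : IsOfAbelianType BraceZ4 :=
  add_comm (G := ZMod 4)

theorem isOfAbelianType_braceZ2Z2 : IsOfAbelianType BraceZ2Z2 :=
  add_comm (G := ZMod 2 × ZMod 2)

theorem isOfAbelianType_braceZ2Z4 : IsOfAbelianType BraceZ2Z4 :=
  add_comm (G := ZMod 2 × ZMod 4)

theorem movesSingleCoset_braceZ4 : MovesSingleCoset BraceZ4 :=
  ⟨AddSubgroup.index_eq_two_iff'.2 (by unfold Xor; decide), by decide⟩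

theorem movesSingleCoset_braceZ2Z2 : MovesSingleCoset BraceZ2Z2 :=
  ⟨AddSubgroup.index_eq_two_iff'.2 (by unfold Xor; decide), by decide⟩

theorem movesSingleCoset_braceZ2Z4 : MovesSingleCoset BraceZ2Z4 :=
  ⟨AddSubgroup.index_eq_two_iff'.2 (by unfold Xor; decide +kernel), by decide +kernel⟩

theorem card_braceZ4 : Nat.card BraceZ4 = 4 :=
  Nat.card_eq_fintype_card

theorem card_braceZ2Z2 : Nat.card BraceZ2Z2 = 4 :=
  Nat.card_eq_fintype_card

theorem card_braceZ2Z4 : Nat.card BraceZ2Z4 = 8 :=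
  Nat.card_eq_fintype_card

/-- The generator `1` of `ℤ/4`, used as a base point not fixed by `λ`. In `BraceZ4` itself the
numeral `1` denotes the neutral element `0` of the circle operation. -/
def basePointZ4 : BraceZ4 :=
  (1 : ZMod 4)

/-- The second standard generator of `ℤ/2 × ℤ/2`, used as a base point not fixed by `λ`. -/
def basePointZ2Z2 : BraceZ2Z2 :=
  ((0, 1) : ZMod 2 × ZMod 2)

/-- The second standard generator of `ℤ/2 × ℤ/4`, used as a base point not fixed by `λ`. -/
def basePointZ2Z4 : BraceZ2Z4 :=
  ((0, 1) : ZMod 2 × ZMod 4)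

theorem exists_addMonoidHom_zmod {M : Type u} [AddGroup M] (n : ℕ) (x : M) (hx : n • x = 0) :
    ∃ φ : ZMod n →+ M, φ 1 = x :=
  ⟨ZMod.lift n ⟨zmultiplesHom M x, by simpa using hx⟩, by
    simpa using ZMod.lift_coe n ⟨zmultiplesHom M x, by simpa using hx⟩ 1⟩

theorem exists_addMonoidHom_zmod_prod {M : Type u} [AddCommGroup M] (m n : ℕ) (x y : M)
    (hx : m • x = 0) (hy : n • y = 0) :
    ∃ φ : ZMod m × ZMod n →+ M, φ (1, 0) = x ∧ φ (0, 1) = y := by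
  obtain ⟨α, rfl⟩ := exists_addMonoidHom_zmod m x hx
  obtain ⟨β, rfl⟩ := exists_addMonoidHom_zmod n y hy
  exact ⟨α.coprod β, by simp, by simp⟩

namespace MovesSingleCoset

variable {B : Type u} [SkewBrace B] {c : B}

theorem nonempty_iso_braceZ4 (h : MovesSingleCoset B) (hab : IsOfAbelianType B)
    (hc : c ∉ fixedPoints B) (hu : displacement c (displacement c c) = 0)
    (hcc : c + c = displacement c c) : Nonempty (Iso B BraceZ4) := by
  have hv := h.add_self_eq_zero hab (displacement_mem_fixedPoints h.index_fixedPoints c c)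
  have h4 : 4 • c = 0 := by
    rw [show 4 = 2 * 2 from rfl, mul_nsmul, two_nsmul, two_nsmul, hcc, hv]
  obtain ⟨φ, rfl⟩ : ∃ φ : BraceZ4 →+ B, φ basePointZ4 = c := exists_addMonoidHom_zmod 4 c h4
  have hφ : RespectsBasePoint φ basePointZ4 :=
    { notMem := by decide
      map_notMem := hc
      map_displacement_self := by
        rw [← hcc, ← map_add]
        exact congrArg φ (by decide)
      map_displacement_displacement := by
        rw [hu, ← map_zero φ]
        exact congrArg φ (by decide) }
  exact hφ.nonempty_iso movesSingleCoset_braceZ4 isOfAbelianType_braceZ4 h hab fun _ => by decide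

theorem nonempty_iso_braceZ2Z2 (h : MovesSingleCoset B) (hab : IsOfAbelianType B)
    (hc : c ∉ fixedPoints B) (hu : displacement c (displacement c c) = 0) (hcc : c + c = 0) :
    Nonempty (Iso B BraceZ2Z2) := by
  have hv := h.add_self_eq_zero hab (displacement_mem_fixedPoints h.index_fixedPoints c c)
  let _ := hab.addCommGroup
  obtain ⟨φ, hφv, rfl⟩ : ∃ φ : BraceZ2Z2 →+ B,
      φ (displacement basePointZ2Z2 basePointZ2Z2) = displacement c c ∧ φ basePointZ2Z2 = c :=
    exists_addMonoidHom_zmod_prod 2 2 _ c ((two_nsmul _).trans hv) ((two_nsmul c).trans hcc)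
  have hφ : RespectsBasePoint φ basePointZ2Z2 :=
    { notMem := by decide
      map_notMem := hc
      map_displacement_self := hφv
      map_displacement_displacement := by
        rw [hu, ← map_zero φ]
        exact congrArg φ (by decide) }
  exact hφ.nonempty_iso movesSingleCoset_braceZ2Z2 isOfAbelianType_braceZ2Z2 h hab fun _ => by
    decide

theorem nonempty_iso_braceZ2Z4 (h : MovesSingleCoset B) (hab : IsOfAbelianType B)
    (hc : c ∉ fixedPoints B) (hu : displacement c (displacement c c) ≠ 0)
    (hcc : c + c = displacement c c) : Nonempty (Iso B BraceZ2Z4) := by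
  have hδ (x : B) := h.add_self_eq_zero hab (displacement_mem_fixedPoints h.index_fixedPoints c x)
  have h4 : 4 • c = 0 := by
    rw [show 4 = 2 * 2 from rfl, mul_nsmul, two_nsmul, two_nsmul, hcc, hδ]
  let _ := hab.addCommGroup
  obtain ⟨φ, hφu, rfl⟩ : ∃ φ : BraceZ2Z4 →+ B,
      φ (displacement basePointZ2Z4 (displacement basePointZ2Z4 basePointZ2Z4)) =
        displacement c (displacement c c) ∧ φ basePointZ2Z4 = c :=
    exists_addMonoidHom_zmod_prod 2 4 _ c ((two_nsmul _).trans (hδ _)) h4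
  have hφ : RespectsBasePoint φ basePointZ2Z4 :=
    { notMem := by decide
      map_notMem := hc
      map_displacement_self := by
        rw [← hcc, ← map_add]
        exact congrArg φ (by decide)
      map_displacement_displacement := hφu }
  exact hφ.nonempty_iso movesSingleCoset_braceZ2Z4 isOfAbelianType_braceZ2Z4 h hab (absurd · hu)

theorem exists_add_self_eq_displacement_self (h : MovesSingleCoset B) (hab : IsOfAbelianType B)
    (hc : c ∉ fixedPoints B) (hu : displacement c (displacement c c) ≠ 0) :
    ∃ b ∉ fixedPoints B, displacement b (displacement b b) ≠ 0 ∧ b + b = displacement b b := by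
  have hF := h.index_fixedPoints
  have hv_mem := displacement_mem_fixedPoints hF c c
  have hδ_cc := h.displacement_add_self hab hc
  have hcc_mem : c + c ∈ fixedPoints B := (AddSubgroup.add_mem_iff_of_index_two hF).2 Iff.rfl
  rcases h.eq_of_mem_fixedPoints hab hc hcc_mem with hcc | hcc | hcc | hcc
  · rw [hcc, displacement_zero] at hδ_cc
    exact absurd hδ_cc.symm hu
  · rw [hcc, h.displacement_displacement_displacement hab hc] at hδ_cc
    exact absurd hδ_cc.symm hu
  · exact ⟨c, hc, hu, hcc⟩
  · have hb : c + displacement c c ∉ fixedPoints B := by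
      rwa [AddSubgroup.add_mem_cancel_right _ hv_mem]
    refine ⟨_, hb, ?_⟩
    let _ := hab.addCommGroup
    rw [displacement_eq_of_notMem_fixedPoints hF hb hc, displacement_add_displacement hF,
      displacement_add_displacement hF, h.displacement_displacement_displacement hab hc, add_zero,
      add_add_add_comm, h.add_self_eq_zero hab hv_mem, add_zero]
    exact ⟨hu, hcc⟩

theorem classification (h : MovesSingleCoset B) (hab : IsOfAbelianType B) :
    Nonempty (Iso B BraceZ4) ∨ Nonempty (Iso B BraceZ2Z2) ∨ Nonempty (Iso B BraceZ2Z4) := by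
  have hF := h.index_fixedPoints
  obtain ⟨c, hc⟩ := exists_notMem_of_index_eq_two hF
  by_cases hu : displacement c (displacement c c) = 0
  · have hcc_mem : c + c ∈ fixedPoints B := (AddSubgroup.add_mem_iff_of_index_two hF).2 Iff.rfl
    have hcc : c + c = 0 ∨ c + c = displacement c c := by
      rcases h.eq_of_mem_fixedPoints hab hc hcc_mem with h0 | h0 | h0 | h0 <;> simp [h0, hu]
    rcases hcc with hcc | hcc
    · exact .inr (.inl (h.nonempty_iso_braceZ2Z2 hab hc hu hcc))
    · exact .inl (h.nonempty_iso_braceZ4 hab hc hu hcc)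
  · obtain ⟨b, hb, hub, hbb⟩ := h.exists_add_self_eq_displacement_self hab hc hu
    exact .inr (.inr (h.nonempty_iso_braceZ2Z4 hab hb hub hbb))

end MovesSingleCoset

end SkewBrace

theorem mainTheorem10 {B : Type*} [SkewBrace B] [Finite B]
    (hab : SkewBrace.IsOfAbelianType B)
    (hone : HasExactlyOneVertex (lambdaGraph B)) :
    (Nonempty (SkewBrace.Iso B BraceZ4) ∨
      Nonempty (SkewBrace.Iso B BraceZ2Z2) ∨
      Nonempty (SkewBrace.Iso B BraceZ2Z4)) ∧
    Nat.card B ≤ 8 := by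
  have hiso := (SkewBrace.movesSingleCoset_of_hasExactlyOneVertex hone).classification hab
  refine ⟨hiso, ?_⟩
  rcases hiso with ⟨⟨e⟩⟩ | ⟨⟨e⟩⟩ | ⟨⟨e⟩⟩ <;> rw [Nat.card_congr e.toEquiv]
  · exact SkewBrace.card_braceZ4.trans_le (by norm_num)
  · exact SkewBrace.card_braceZ2Z2.trans_le (by norm_num)
  · exact SkewBrace.card_braceZ2Z4.le
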